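/- Let $\mathbb{C}$ be a category with finite limits, let $\Sigma:\mathbb{C}\to\mathbb{C}$ be an endofunctor for which free $\Sigma$-algebras exist, and let $(\Sigma^*,\eta^\Sigma,\mu^\Sigma)$ be the resulting free monad. Let $(T,\eta,\mu)$ be a monad on $\mathbb{C}$ whose Kleisli category $\mathcal{K}\ell(T)$ (composition $\diamond$) is $\omega\text{-}\mathbf{Cpo}^{\vee}$-enriched: every hom-set carries a partial order with all finite joins; $i\diamond(f\vee g)=(i\diamond f)\vee(i\diamond g)$; every ascending $\omega$-chain has a supremum; and $\diamond$ preserves suprema of ascending $\omega$-chains in each argument. For $f:X\to TX$ write $f^*=\bigvee_{n<\omega}(\eta_X\vee f)^n$ (powers in $\mathcal{K}\ell(T)$), the least $\beta\ge f$ with $\eta_X\le\beta$ and $\beta\diamond\beta\le\beta$. Assume that either $\mathbb{C}$ is finitely extensive (for instance $\mathbb{C}=\mathbf{Set}$) or joins in $\mathcal{K}\ell(T)$ are preserved by precomposition with morphisms of $\mathbb{C}$, i.e. $(f\vee g)\circ j=(f\circ j)\vee(g\circ j)$ for all $f,g:X\to TY$ and $j:W\to X$ in $\mathbb{C}$. Assume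 that $T$ preserves weak pullbacks and has a final coalgebra, and let $a:\Sigma A\to A$ be an initial $\Sigma$-algebra. Let $\lambda_X:\Sigma^*(X\times TX)\to T\Sigma^*X$ be a GSOS law, i.e. a natural transformation with $\lambda\circ\eta^\Sigma=T\eta^\Sigma\circ\pi_2$ and $\lambda\circ\mu^\Sigma=T\mu^\Sigma\circ\lambda_{\Sigma^*}\circ\Sigma^*\langle\Sigma^*\pi_1,\lambda\rangle$, which satisfies the three compositionality criteria: 1. (Continuity) $\lambda_X\circ\Sigma^*\langle \mathrm{id},\bigvee_i f_i\rangle=\bigvee_i\big(\lambda_X\circ\Sigma^*\langle \mathrm{id},f_i\rangle\big)$ for every ascending $\omega$-chain $f_0\le f_1\le\cdots: X\to TX$; 2. (Unitality) $\lambda_X\circ\Sigma^*\langle \mathrm{id},\eta_X\vee f\rangle\le\big(\lambda_X\circ\Sigma^*\langle \mathrm{id},f\rangle\big)^*$ for every $f:X\to TX$; 3. (Observability) $\lambda_X\circ\Sigma^*\langle \mathrm{id},f\diamond f\rangle\le\big(\lambda_X\circ\Sigma^*\langle \mathrm{id},f\rangle\big)^*$ for every $f:X\to TX$. Let $h:A\to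 TA$ be the operational model of $\lambda$, i.e. $h\circ a^{\#}=Ta^{\#}\circ\lambda_A\circ\Sigma^*\langle\mathrm{id},h\rangle$, where $a^{\#}:\Sigma^*A\to A$ is the Eilenberg–Moore algebra induced by $a$. A weak bisimulation for $h$ is a span $r_1,r_2:R\to A$ for which there is $e:R\to TR$ with $Tr_i\circ e=h^*\circ r_i$ for $i=1,2$; generalized elements $x,y:U\to A$ are weakly bisimilar if $(x,y)$ factors through some weak bisimulation. Then weak bisimilarity is a congruence: there is a greatest weak bisimulation $r_1,r_2:R\to A$ for $h$; two generalized elements of $A$ are weakly bisimilar if and only if they factor jointly through it; $(r_1,r_2)$ is jointly monic and is an (internal) equivalence relation on $A$; and $R$ carries a $\Sigma$-algebra structure $b:\Sigma R\to R$ for which $r_1$ and $r_2$ are $\Sigma$-algebra homomorphisms to $(A,a)$. -/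

import Mathlib

open CategoryTheory CategoryTheory.Limits

namespace WeakBisim

/-! ### Order-enriched categories and free monads of endomorphisms -/

section Enrichment

universe v u

/-- `ω-Cpo^∨`-enrichment of a category: every hom-set is a partial order with all finite joins,
composition is left-distributive over joins (`i ∘ (f ∨ g) = i ∘ f ∨ i ∘ g`), every ascending
`ω`-chain of parallel morphisms has a supremum, and composition is continuous in each argument.
(Mathlib writes `f ≫ g` for `g ∘ f`.) -/
class OmegaCpoJoinEnriched (K : Type u) [Category.{v} K] where
  [semilatticeSup : ∀ X Y : K, SemilatticeSup (X ⟶ Y)]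
  [orderBot : ∀ X Y : K, OrderBot (X ⟶ Y)]
  sup_comp : ∀ {X Y Z : K} (f g : X ⟶ Y) (i : Y ⟶ Z), (f ⊔ g) ≫ i = f ≫ i ⊔ g ≫ i
  exists_isLUB : ∀ {X Y : K} (f : ℕ → (X ⟶ Y)), Monotone f → ∃ s, IsLUB (Set.range f) s
  isLUB_comp_right : ∀ {X Y Z : K} (f : ℕ → (X ⟶ Y)) (s : X ⟶ Y) (g : Y ⟶ Z), Monotone f →
    IsLUB (Set.range f) s → IsLUB (Set.range fun n => f n ≫ g) (s ≫ g)
  isLUB_comp_left : ∀ {X Y Z : K} (f : X ⟶ Y) (g : ℕ → (Y ⟶ Z)) (s : Y ⟶ Z), Monotone g →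
    IsLUB (Set.range g) s → IsLUB (Set.range fun n => f ≫ g n) (f ≫ s)

attribute [reducible, instance] OmegaCpoJoinEnriched.semilatticeSup OmegaCpoJoinEnriched.orderBot

variable {K : Type u} [Category.{v} K] [OmegaCpoJoinEnriched K]

theorem comp_le_comp_left {X Y Z : K} (f : X ⟶ Y) {g g' : Y ⟶ Z} (h : g ≤ g') :
    f ≫ g ≤ f ≫ g' := by
  have hm : Monotone (fun n : ℕ => if n = 0 then g else g') := by
    refine monotone_nat_of_le_succ fun n => ?_
    by_cases hn : n = 0 <;> simp [hn, h]
  have hs : IsLUB (Set.range fun n : ℕ => if n = 0 then g else g') g' := by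
    refine ⟨?_, fun b hb => by simpa using hb ⟨1, rfl⟩⟩
    rintro _ ⟨n, rfl⟩
    by_cases hn : n = 0 <;> simp [hn, h]
  simpa using (OmegaCpoJoinEnriched.isLUB_comp_left f _ _ hm hs).1 ⟨0, rfl⟩

theorem comp_le_comp_right {X Y Z : K} {f f' : X ⟶ Y} (h : f ≤ f') (g : Y ⟶ Z) :
    f ≫ g ≤ f' ≫ g := by
  have : f ⊔ f' = f' := sup_eq_right.mpr h
  rw [← this, OmegaCpoJoinEnriched.sup_comp]
  exact le_sup_left

/-- The `n`-fold composite of `id ∨ α`. -/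
def rtIter {X : K} (α : X ⟶ X) : ℕ → (X ⟶ X)
  | 0 => 𝟙 X
  | n + 1 => rtIter α n ≫ (𝟙 X ⊔ α)

theorem rtIter_monotone {X : K} (α : X ⟶ X) : Monotone (rtIter α) := by
  refine monotone_nat_of_le_succ fun n => ?_
  calc rtIter α n = rtIter α n ≫ 𝟙 X := (Category.comp_id _).symm
    _ ≤ rtIter α n ≫ (𝟙 X ⊔ α) := comp_le_comp_left _ le_sup_left

/-- The free monad (reflexive transitive closure) of an endomorphism `α`,
`α^* = ⋁ n, (id ∨ α)^n`. -/
noncomputable def rtClosure {X : K} (α : X ⟶ X) : X ⟶ X :=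
  (OmegaCpoJoinEnriched.exists_isLUB (rtIter α) (rtIter_monotone α)).choose

theorem isLUB_rtClosure {X : K} (α : X ⟶ X) : IsLUB (Set.range (rtIter α)) (rtClosure α) :=
  (OmegaCpoJoinEnriched.exists_isLUB (rtIter α) (rtIter_monotone α)).choose_spec

/-- A monad (closure operator) on an object of an order-enriched category. -/
def IsClosureOperator {X : K} (β : X ⟶ X) : Prop := 𝟙 X ≤ β ∧ β ≫ β ≤ β

/-- `rtClosure α` is the free monad over `α`: the least closure operator above `α`. -/
theorem rtClosure_isLeast {X : K} (α : X ⟶ X) :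
    IsLeast {β : X ⟶ X | IsClosureOperator β ∧ α ≤ β} (rtClosure α) := by
  have hl := isLUB_rtClosure α
  have hle : ∀ n, rtIter α n ≤ rtClosure α := fun n => hl.1 ⟨n, rfl⟩
  have hadd : ∀ m n, rtIter α m ≫ rtIter α n = rtIter α (m + n) := by
    intro m n
    induction n with
    | zero => simp [rtIter]
    | succ n ih => rw [← Nat.add_assoc, rtIter, ← Category.assoc, ih, rtIter]
  refine ⟨⟨⟨hle 0, ?_⟩, ?_⟩, ?_⟩
  · refine (OmegaCpoJoinEnriched.isLUB_comp_right _ _ (rtClosure α) (rtIter_monotone α) hl).2 ?_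
    rintro _ ⟨m, rfl⟩
    refine (OmegaCpoJoinEnriched.isLUB_comp_left (rtIter α m) _ _ (rtIter_monotone α) hl).2 ?_
    rintro _ ⟨n, rfl⟩
    change rtIter α m ≫ rtIter α n ≤ rtClosure α
    rw [hadd]
    exact hle _
  · refine le_trans ?_ (hle 1)
    simp [rtIter]
  · rintro β ⟨⟨h1, h2⟩, h3⟩
    refine hl.2 ?_
    rintro _ ⟨n, rfl⟩
    induction n with
    | zero => exact h1
    | succ n ih =>
      exact (comp_le_comp_right ih _).trans ((comp_le_comp_left _ (sup_le h1 h3)).trans h2)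

end Enrichment

universe v u

variable {C : Type u} [Category.{v} C]

/-! ### Kleisli morphisms -/

/-- A morphism `f : X ⟶ T Y` seen as a morphism of the Kleisli category of `T`. -/
def kl {T : Monad C} {X Y : C} (f : X ⟶ T.obj Y) : Kleisli.mk T X ⟶ Kleisli.mk T Y :=
  Kleisli.Hom.mk f

/-- A morphism `j` of the base category seen as the Kleisli morphism `η ∘ j`. -/
def pureKl (T : Monad C) {X Y : C} (j : X ⟶ Y) : Kleisli.mk T X ⟶ Kleisli.mk T Y :=
  kl (j ≫ T.η.app Y)

/-- Joins of Kleisli morphisms are stable under precomposition with the (images of) morphisms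
of the base category. -/
def PureRightDistributive (T : Monad C) [OmegaCpoJoinEnriched (Kleisli T)] : Prop :=
  ∀ {W X Y : C} (j : W ⟶ X) (f g : Kleisli.mk T X ⟶ Kleisli.mk T Y),
    pureKl T j ≫ (f ⊔ g) = pureKl T j ≫ f ⊔ pureKl T j ≫ g

/-! ### Weak pullbacks -/

/-- A commutative square `fst ≫ f = snd ≫ g` that is a weak pullback: every competing cone
factors through it, not necessarily uniquely. -/
structure IsWeakPullback {P X Y Z : C} (fst : P ⟶ X) (snd : P ⟶ Y) (f : X ⟶ Z) (g : Y ⟶ Z) :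
    Prop extends CommSq fst snd f g where
  exists_lift : ∀ {W : C} (a : W ⟶ X) (b : W ⟶ Y), a ≫ f = b ≫ g →
    ∃ l : W ⟶ P, l ≫ fst = a ∧ l ≫ snd = b

/-- A functor preserves weak pullbacks if it maps weak pullback squares to such squares. -/
def PreservesWeakPullbacks (F : C ⥤ C) : Prop :=
  ∀ {P X Y Z : C} {fst : P ⟶ X} {snd : P ⟶ Y} {f : X ⟶ Z} {g : Y ⟶ Z},
    IsWeakPullback fst snd f g → IsWeakPullback (F.map fst) (F.map snd) (F.map f) (F.map g)

/-! ### GSOS laws and bialgebras -/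

/-- A GSOS law over the monad `S` (in the application: the free monad `Σ^*` over the syntax
functor) and the behaviour functor `B`, in the form of a natural transformation
`S (Id × B) ⟹ B S` that respects the monad structure of `S`. -/
structure GSOSLaw [HasBinaryProducts C] (S : Monad C) (B : C ⥤ C) where
  app : ∀ X : C, S.obj (X ⨯ B.obj X) ⟶ B.obj (S.obj X)
  naturality : ∀ {X Y : C} (f : X ⟶ Y),
    S.map (prod.map f (B.map f)) ≫ app Y = app X ≫ B.map (S.map f)
  mult : ∀ X : C,
    S.map (prod.lift (S.map prod.fst) (app X)) ≫ app (S.obj X) ≫ B.map (S.μ.app X) =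
      S.μ.app (X ⨯ B.obj X) ≫ app X
  unit : ∀ X : C, S.η.app (X ⨯ B.obj X) ≫ app X = prod.snd ≫ B.map (S.η.app X)

/-- The coalgebra `λ ∘ S⟨id, f⟩ : S X ⟶ T (S X)` of terms over a coalgebra `f : X ⟶ T X`, as an
endomorphism in the Kleisli category. -/
noncomputable def GSOSLaw.lift [HasBinaryProducts C] {S T : Monad C}
    (lam : GSOSLaw S T.toFunctor) {X : C} (f : Kleisli.mk T X ⟶ Kleisli.mk T X) :
    Kleisli.mk T (S.obj X) ⟶ Kleisli.mk T (S.obj X) :=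
  kl (S.map (prod.lift (𝟙 X) f.of) ≫ lam.app X)

/-- The Eilenberg-Moore algebra `g^# : Σ^* X ⟶ X` induced by a `Σ`-algebra `g : Σ X ⟶ X`, where
`Σ^*` is the monad of the free-forgetful adjunction for `Σ`-algebras. -/
def emAlgebra {Sig : C ⥤ C} {L : C ⥤ Endofunctor.Algebra Sig}
    (adj : L ⊣ Endofunctor.Algebra.forget Sig) (A : Endofunctor.Algebra Sig) :
    adj.toMonad.obj A.a ⟶ A.a :=
  (Endofunctor.Algebra.forget Sig).map (adj.counit.app A)

/-- A `Σ`-algebra and a `B`-coalgebra on the same carrier form a bialgebra for a GSOS law. -/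
def IsBialgebra [HasBinaryProducts C] {Sig B : C ⥤ C} {L : C ⥤ Endofunctor.Algebra Sig}
    (adj : L ⊣ Endofunctor.Algebra.forget Sig) (lam : GSOSLaw adj.toMonad B)
    (A : Endofunctor.Algebra Sig) (h : A.a ⟶ B.obj A.a) : Prop :=
  emAlgebra adj A ≫ h =
    adj.toMonad.map (prod.lift (𝟙 A.a) h) ≫ lam.app A.a ≫ B.map (emAlgebra adj A)

/-! ### The three compositionality criteria -/

section Criteria

variable [HasBinaryProducts C] {S T : Monad C} [OmegaCpoJoinEnriched (Kleisli T)]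

/-- Continuity: `λ ∘ S⟨id, ⋁ f_i⟩ = ⋁ (λ ∘ S⟨id, f_i⟩)` for ascending chains `f_i`. -/
def GSOSLaw.Continuity (lam : GSOSLaw S T.toFunctor) : Prop :=
  ∀ {X : C} (f : ℕ → (Kleisli.mk T X ⟶ Kleisli.mk T X)) (s : Kleisli.mk T X ⟶ Kleisli.mk T X),
    Monotone f → IsLUB (Set.range f) s → IsLUB (Set.range fun n => lam.lift (f n)) (lam.lift s)

/-- Unitality: `λ ∘ S⟨id, η ∨ f⟩ ≤ (λ ∘ S⟨id, f⟩)^*`. The Kleisli identity is `η`. -/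
def GSOSLaw.Unitality (lam : GSOSLaw S T.toFunctor) : Prop :=
  ∀ {X : C} (f : Kleisli.mk T X ⟶ Kleisli.mk T X),
    lam.lift (𝟙 (Kleisli.mk T X) ⊔ f) ≤ rtClosure (lam.lift f)

/-- Observability: `λ ∘ S⟨id, f ⋄ f⟩ ≤ (λ ∘ S⟨id, f⟩)^*`, with `⋄` Kleisli composition. -/
def GSOSLaw.Observability (lam : GSOSLaw S T.toFunctor) : Prop :=
  ∀ {X : C} (f : Kleisli.mk T X ⟶ Kleisli.mk T X),
    lam.lift (f ≫ f) ≤ rtClosure (lam.lift f)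

end Criteria

/-! ### Weak bisimulation and congruences -/

/-- A span `r₁, r₂ : R ⟶ X` is an Aczel-Mendler bisimulation for a coalgebra `f`. -/
def IsBisimulation (F : C ⥤ C) {X R : C} (f : X ⟶ F.obj X) (r₁ r₂ : R ⟶ X) : Prop :=
  ∃ e : R ⟶ F.obj R, e ≫ F.map r₁ = r₁ ≫ f ∧ e ≫ F.map r₂ = r₂ ≫ f

/-- A weak bisimulation for `h : X ⟶ T X` is a bisimulation for `h^*`. -/
def IsWeakBisimulation (T : Monad C) [OmegaCpoJoinEnriched (Kleisli T)] {X R : C}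
    (h : X ⟶ T.obj X) (r₁ r₂ : R ⟶ X) : Prop :=
  IsBisimulation T.toFunctor (rtClosure (kl h)).of r₁ r₂

/-- The pair of generalized elements `x, y` of `X` lies in the span `r₁, r₂`. (In the category of
types, ordinary elements are the case `U = PUnit`.) -/
def RelatedBy {X R U : C} (r₁ r₂ : R ⟶ X) (x y : U ⟶ X) : Prop :=
  ∃ u : U ⟶ R, u ≫ r₁ = x ∧ u ≫ r₂ = y

/-- Weak bisimilarity `x ≈ y`: some weak bisimulation contains the pair. -/
def WeaklyBisimilar (T : Monad C) [OmegaCpoJoinEnriched (Kleisli T)] {X U : C}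
    (h : X ⟶ T.obj X) (x y : U ⟶ X) : Prop :=
  ∃ (R : C) (r₁ r₂ : R ⟶ X), IsWeakBisimulation T h r₁ r₂ ∧ RelatedBy r₁ r₂ x y

/-- The span `r₁, r₂` is a greatest weak bisimulation for `h`. -/
def IsGreatestWeakBisimulation (T : Monad C) [OmegaCpoJoinEnriched (Kleisli T)] {X R : C}
    (h : X ⟶ T.obj X) (r₁ r₂ : R ⟶ X) : Prop :=
  IsWeakBisimulation T h r₁ r₂ ∧
    ∀ {Q : C} (q₁ q₂ : Q ⟶ X), IsWeakBisimulation T h q₁ q₂ → RelatedBy r₁ r₂ q₁ q₂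

/-- The span `r₁, r₂` is a congruence on the algebra `A`: it is a relation (jointly monic), an
equivalence relation, and it is closed under the operations of `A`, that is, it carries an
algebra structure for which `r₁` and `r₂` are homomorphisms. -/
structure IsCongruence {F : C ⥤ C} (A : Endofunctor.Algebra F) {R : C} (r₁ r₂ : R ⟶ A.a) :
    Prop where
  jointly_mono : ∀ {U : C} (u v : U ⟶ R), u ≫ r₁ = v ≫ r₁ → u ≫ r₂ = v ≫ r₂ → u = v
  equivalence : ∀ U : C, Equivalence fun x y : U ⟶ A.a => RelatedBy r₁ r₂ x y
  compatible : ∃ b : F.obj R ⟶ R, b ≫ r₁ = F.map r₁ ≫ A.str ∧ b ≫ r₂ = F.map r₂ ≫ A.str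

end WeakBisim

namespace WeakBisim

/-! ### Closures of endomorphisms in an order-enriched category -/

section Closure

universe v u

variable {K : Type u} [Category.{v} K] [OmegaCpoJoinEnriched K]

/-! Weak bisimilarity is the kernel pair of the unique homomorphism `beh` from the saturated
coalgebra `h^*` to the final coalgebra `Z`. By finality `beh` identifies the two legs of every weak
bisimulation; since `T` preserves weak pullbacks, the kernel pair is itself a weak bisimulation. So
it is the greatest one, and a kernel pair is a jointly monic equivalence relation.

For compatibility, let `e` be a coalgebra structure on the kernel pair `R`. Each projection `r`
induces `Σ^* R ⟶ Σ^* A ⟶ A ⟶ Z`, and both composites are homomorphisms out of the same coalgebra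
`(lift e)^*`, so they agree by finality; restricting to terms of depth one gives the operations on
`R`. That they are homomorphisms rests on `(lift h^*)^* = (lift h)^*`, which is what the three
criteria provide (`GSOSLaw.rtClosure_lift_rtClosure`), and on closure preserving homomorphisms
(`rtClosure_hom`). The latter needs joins to be stable under precomposition with base morphisms,
which `pureRightDistributive_of_finitaryExtensive` derives from extensivity. -/

theorem rtClosure_le_of_le {X : K} {α β : X ⟶ X} (h : α ≤ rtClosure β) :
    rtClosure α ≤ rtClosure β :=
  (rtClosure_isLeast α).2 ⟨(rtClosure_isLeast β).1.1, h⟩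

theorem le_rtClosure {X : K} (α : X ⟶ X) : α ≤ rtClosure α :=
  (rtClosure_isLeast α).1.2

/-- Precomposition with an isomorphism is an order isomorphism of hom-sets. For general morphisms
the enrichment gives only `≥`. -/
theorem iso_comp_sup {X Y Z : K} (i : X ⟶ Y) (k : Y ⟶ X) (hik : i ≫ k = 𝟙 X) (hki : k ≫ i = 𝟙 Y)
    (f g : Y ⟶ Z) : i ≫ (f ⊔ g) = i ≫ f ⊔ i ≫ g := by
  refine le_antisymm ?_ (sup_le (comp_le_comp_left _ le_sup_left) (comp_le_comp_left _ le_sup_right))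
  have : f ⊔ g ≤ k ≫ (i ≫ f ⊔ i ≫ g) := by
    refine sup_le ?_ ?_
    · calc f = k ≫ i ≫ f := by rw [← Category.assoc, hki, Category.id_comp]
        _ ≤ _ := comp_le_comp_left _ le_sup_left
    · calc g = k ≫ i ≫ g := by rw [← Category.assoc, hki, Category.id_comp]
        _ ≤ _ := comp_le_comp_left _ le_sup_right
  calc i ≫ (f ⊔ g) ≤ i ≫ k ≫ (i ≫ f ⊔ i ≫ g) := comp_le_comp_left _ this
    _ = _ := by rw [← Category.assoc, hik, Category.id_comp]

/-- The closures of two endomorphisms intertwined by `p` are intertwined by `p`, as soon as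
precomposition with `p` preserves binary joins. -/
theorem comp_rtClosure_of_comm {X Y : K} {p : X ⟶ Y} {α : X ⟶ X} {β : Y ⟶ Y}
    (hp : p ≫ (𝟙 Y ⊔ β) = p ≫ 𝟙 Y ⊔ p ≫ β) (h : α ≫ p = p ≫ β) :
    rtClosure α ≫ p = p ≫ rtClosure β := by
  have hn : ∀ n, rtIter α n ≫ p = p ≫ rtIter β n := by
    intro n
    induction n with
    | zero => simp [rtIter]
    | succ n ih =>
      have h1 : (𝟙 X ⊔ α) ≫ p = p ≫ (𝟙 Y ⊔ β) := by
        rw [OmegaCpoJoinEnriched.sup_comp, hp, h, Category.id_comp, Category.comp_id]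
      rw [rtIter, rtIter, Category.assoc, h1, ← Category.assoc, ih, Category.assoc]
  have h1 := OmegaCpoJoinEnriched.isLUB_comp_right _ _ p (rtIter_monotone α) (isLUB_rtClosure α)
  have h2 := OmegaCpoJoinEnriched.isLUB_comp_left p _ _ (rtIter_monotone β) (isLUB_rtClosure β)
  simp only [hn] at h1
  exact h1.unique h2

end Closure

universe v u

variable {C : Type u} [Category.{v} C]

/-! ### Base morphisms inside the Kleisli category -/

section Pure

variable {T : Monad C}

@[simp]
theorem pureKl_id (X : C) : pureKl T (𝟙 X) = 𝟙 (Kleisli.mk T X) :=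
  (Kleisli.Adjunction.toKleisli T).map_id X

theorem pureKl_comp {X Y Z : C} (f : X ⟶ Y) (g : Y ⟶ Z) :
    pureKl T (f ≫ g) = pureKl T f ≫ pureKl T g :=
  (Kleisli.Adjunction.toKleisli T).map_comp f g

theorem pureKl_comp_of {W X Y : C} (j : W ⟶ X) (f : Kleisli.mk T X ⟶ Kleisli.mk T Y) :
    (pureKl T j ≫ f).of = j ≫ f.of := by
  change (j ≫ T.η.app X) ≫ T.map f.of ≫ T.μ.app Y = j ≫ f.of
  have h1 : T.η.app X ≫ T.map f.of = f.of ≫ T.η.app (T.obj Y) := (T.η.naturality f.of).symm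
  rw [Category.assoc, reassoc_of% h1]
  simp

theorem comp_pureKl_of {W X Y : C} (f : Kleisli.mk T W ⟶ Kleisli.mk T X) (j : X ⟶ Y) :
    (f ≫ pureKl T j).of = f.of ≫ T.map j := by
  change f.of ≫ T.map (j ≫ T.η.app Y) ≫ T.μ.app Y = f.of ≫ T.map j
  simp

theorem comp_pureKl_eq_iff {X Y : C} (α : Kleisli.mk T X ⟶ Kleisli.mk T X)
    (β : Kleisli.mk T Y ⟶ Kleisli.mk T Y) (p : X ⟶ Y) :
    α ≫ pureKl T p = pureKl T p ≫ β ↔ α.of ≫ T.map p = p ≫ β.of := by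
  rw [← pureKl_comp_of, ← comp_pureKl_of]
  exact ⟨fun h => by rw [h], fun h => Kleisli.hom_ext h⟩

/-- A coalgebra homomorphism stays a homomorphism after reflexive transitive closure. -/
theorem rtClosure_hom [OmegaCpoJoinEnriched (Kleisli T)] (hP : PureRightDistributive T) {X Y : C}
    {α : Kleisli.mk T X ⟶ Kleisli.mk T X} {β : Kleisli.mk T Y ⟶ Kleisli.mk T Y} {p : X ⟶ Y}
    (h : α.of ≫ T.map p = p ≫ β.of) :
    (rtClosure α).of ≫ T.map p = p ≫ (rtClosure β).of := by
  rw [← comp_pureKl_eq_iff] at h ⊢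
  exact comp_rtClosure_of_comm (hP p _ _) h

end Pure

/-! ### Joins in the Kleisli category over a finitely extensive base -/

section Extensive

/-- By extensivity, a map `b` into `X ⨿ X` splits its domain as the coproduct of the preimages of
the two summands; the lift is `a` followed by `inl` on one piece and by `inr` on the other. -/
theorem isWeakPullback_codiag [HasPullbacks C] [FinitaryExtensive C] {W X : C} (j : W ⟶ X) :
    IsWeakPullback (coprod.desc (𝟙 W) (𝟙 W)) (coprod.map j j) j (coprod.desc (𝟙 X) (𝟙 X)) where
  w := by ext <;> simp [coprod.inl_desc, coprod.inr_desc]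
  exists_lift {U} a b hab := by
    obtain ⟨hc⟩ := ((BinaryCofan.isVanKampen_iff _).1
      (FinitaryExtensive.van_kampen' _ (coprodIsCoprod X X))
      (BinaryCofan.mk (pullback.fst b coprod.inl) (pullback.fst b coprod.inr))
      (pullback.snd b coprod.inl) (pullback.snd b coprod.inr) b
      pullback.condition.symm pullback.condition.symm).2
      ⟨IsPullback.of_hasPullback _ _, IsPullback.of_hasPullback _ _⟩
    obtain ⟨l, hl₁, hl₂⟩ : ∃ l : U ⟶ W ⨿ W,
        pullback.fst b coprod.inl ≫ l = pullback.fst b coprod.inl ≫ a ≫ coprod.inl ∧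
        pullback.fst b coprod.inr ≫ l = pullback.fst b coprod.inr ≫ a ≫ coprod.inr :=
      have l := BinaryCofan.IsColimit.desc' hc _ _
      ⟨l.1, l.2.1, l.2.2⟩
    have hinl := pullback.condition (f := b) (g := (coprod.inl : X ⟶ X ⨿ X))
    have hinr := pullback.condition (f := b) (g := (coprod.inr : X ⟶ X ⨿ X))
    refine ⟨l, BinaryCofan.IsColimit.hom_ext hc ?_ ?_, BinaryCofan.IsColimit.hom_ext hc ?_ ?_⟩
    · change pullback.fst b coprod.inl ≫ l ≫ _ = pullback.fst b coprod.inl ≫ a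
      rw [reassoc_of% hl₁, coprod.inl_desc, Category.comp_id]
    · change pullback.fst b coprod.inr ≫ l ≫ _ = pullback.fst b coprod.inr ≫ a
      rw [reassoc_of% hl₂, coprod.inr_desc, Category.comp_id]
    · change pullback.fst b coprod.inl ≫ l ≫ _ = pullback.fst b coprod.inl ≫ b
      rw [reassoc_of% hl₁, coprod.inl_map, reassoc_of% hab, reassoc_of% hinl,
        coprod.inl_desc_assoc, Category.id_comp, hinl]
    · change pullback.fst b coprod.inr ≫ l ≫ _ = pullback.fst b coprod.inr ≫ b
      rw [reassoc_of% hl₂, coprod.inr_map, reassoc_of% hab, reassoc_of% hinr,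
        coprod.inr_desc_assoc, Category.id_comp, hinr]

variable {T : Monad C}

/-- `T` keeps the codiagonal square a weak pullback, and by naturality of `η` the pair `η_W`, `d` is
a cone over its image. -/
theorem exists_kleisli_lift_codiag [HasPullbacks C] [FinitaryExtensive C]
    (hT : PreservesWeakPullbacks T.toFunctor) {W X : C} (j : W ⟶ X)
    (d : Kleisli.mk T W ⟶ Kleisli.mk T (X ⨿ X))
    (hd : d ≫ pureKl T (coprod.desc (𝟙 X) (𝟙 X)) = pureKl T j) :
    ∃ l : Kleisli.mk T W ⟶ Kleisli.mk T (W ⨿ W),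
      l ≫ pureKl T (coprod.desc (𝟙 W) (𝟙 W)) = 𝟙 _ ∧ l ≫ pureKl T (coprod.map j j) = d := by
  have hd' := congrArg Kleisli.Hom.of hd
  rw [comp_pureKl_of] at hd'
  obtain ⟨l, h1, h2⟩ := (hT (isWeakPullback_codiag j)).exists_lift (T.η.app W) d.of
    ((T.η.naturality j).symm.trans hd'.symm)
  refine ⟨kl l, Kleisli.hom_ext ?_, Kleisli.hom_ext ?_⟩
  · rw [comp_pureKl_of]; exact h1
  · rw [comp_pureKl_of]; exact h2

variable [OmegaCpoJoinEnriched (Kleisli T)]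

/-- The join of the two coproduct injections as Kleisli morphisms. -/
noncomputable def injJoin (T : Monad C) [OmegaCpoJoinEnriched (Kleisli T)] [HasBinaryCoproducts C]
    (X : C) : Kleisli.mk T X ⟶ Kleisli.mk T (X ⨿ X) :=
  pureKl T coprod.inl ⊔ pureKl T coprod.inr

theorem injJoin_comp_pureKl [HasBinaryCoproducts C] {X Y : C} (f : X ⨿ X ⟶ Y) :
    injJoin T X ≫ pureKl T f = pureKl T (coprod.inl ≫ f) ⊔ pureKl T (coprod.inr ≫ f) := by
  rw [injJoin, OmegaCpoJoinEnriched.sup_comp, pureKl_comp, pureKl_comp]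

theorem injJoin_comp_codiag [HasBinaryCoproducts C] (X : C) :
    injJoin T X ≫ pureKl T (coprod.desc (𝟙 X) (𝟙 X)) = 𝟙 _ := by
  rw [injJoin_comp_pureKl, coprod.inl_desc, coprod.inr_desc, pureKl_id, sup_idem]

/-- The join of the identity and the symmetry of `X ⨿ X` factors through the codiagonal. -/
theorem id_sup_braiding [HasBinaryCoproducts C] (X : C) :
    𝟙 (Kleisli.mk T (X ⨿ X)) ⊔ pureKl T (coprod.desc coprod.inr coprod.inl) =
      pureKl T (coprod.desc (𝟙 X) (𝟙 X)) ≫ pureKl T coprod.inl ≫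
        (𝟙 (Kleisli.mk T (X ⨿ X)) ⊔ pureKl T (coprod.desc coprod.inr coprod.inl)) := by
  have hsw : pureKl T (coprod.desc coprod.inr coprod.inl : X ⨿ X ⟶ X ⨿ X) ≫
      pureKl T (coprod.desc coprod.inr coprod.inl) = 𝟙 _ := by
    rw [← pureKl_comp, ← pureKl_id]
    congr 1
    ext <;> simp [coprod.inl_desc, coprod.inr_desc]
  -- The symmetry is an involution, so the join is invariant under precomposition with it; hence its
  -- two components on `X ⨿ X` coincide.
  have hsym := iso_comp_sup _ _ hsw hsw (𝟙 (Kleisli.mk T (X ⨿ X)))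
    (pureKl T (coprod.desc coprod.inr coprod.inl))
  rw [hsw, Category.comp_id, sup_comm] at hsym
  have hof := congrArg (fun f => coprod.inl ≫ Kleisli.Hom.of f) hsym
  dsimp only at hof
  rw [pureKl_comp_of, coprod.inl_desc_assoc] at hof
  apply Kleisli.hom_ext
  rw [pureKl_comp_of, pureKl_comp_of]
  apply coprod.hom_ext
  · rw [coprod.inl_desc_assoc, Category.id_comp]
  · rw [coprod.inr_desc_assoc, Category.id_comp, sup_comm]
    exact hof

/-- A Kleisli morphism over the diagonal lies below the join of the injections. -/
theorem le_injJoin [HasPullbacks C] [FinitaryExtensive C] (hT : PreservesWeakPullbacks T.toFunctor) {X : C}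
    (d : Kleisli.mk T X ⟶ Kleisli.mk T (X ⨿ X))
    (hd : d ≫ pureKl T (coprod.desc (𝟙 X) (𝟙 X)) = 𝟙 _) : d ≤ injJoin T X := by
  -- Enlarging `d'` by the symmetry gives a morphism depending only on `d' ≫ ∇`, hence a bound
  -- independent of `d'`.
  have hle : ∀ d' : Kleisli.mk T X ⟶ Kleisli.mk T (X ⨿ X),
      d' ≫ pureKl T (coprod.desc (𝟙 X) (𝟙 X)) = 𝟙 _ →
      d' ≤ pureKl T coprod.inl ≫
        (𝟙 (Kleisli.mk T (X ⨿ X)) ⊔ pureKl T (coprod.desc coprod.inr coprod.inl)) := by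
    intro d' hd'
    calc d' = d' ≫ 𝟙 _ := (Category.comp_id _).symm
      _ ≤ d' ≫ (𝟙 _ ⊔ pureKl T (coprod.desc coprod.inr coprod.inl)) :=
        comp_le_comp_left _ le_sup_left
      _ = d' ≫ pureKl T (coprod.desc (𝟙 X) (𝟙 X)) ≫ _ := congrArg (d' ≫ ·) (id_sup_braiding X)
      _ = _ := by rw [reassoc_of% hd']
  refine (hle d hd).trans ?_
  obtain ⟨l, -, hl⟩ := exists_kleisli_lift_codiag hT (coprod.inl : X ⟶ X ⨿ X)
    (pureKl T coprod.inl ≫ injJoin T (X ⨿ X))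
    (by rw [Category.assoc, injJoin_comp_codiag, Category.comp_id])
  -- The bound and `l` are compared by postcomposing `l ≫ (inl ⨿ inl)` in two ways: `[id, swap]`
  -- gives the bound, `∇ ⨿ ∇` gives a join that is estimated using only monotonicity.
  have h1 : pureKl T coprod.inl ≫
      (𝟙 (Kleisli.mk T (X ⨿ X)) ⊔ pureKl T (coprod.desc coprod.inr coprod.inl)) = l := by
    have := injJoin_comp_pureKl (T := T) (coprod.desc (𝟙 (X ⨿ X)) (coprod.desc coprod.inr coprod.inl))
    rw [coprod.inl_desc, coprod.inr_desc, pureKl_id] at this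
    rw [← this, ← Category.assoc, ← hl, Category.assoc, ← pureKl_comp]
    have h : coprod.map coprod.inl coprod.inl ≫
        coprod.desc (𝟙 (X ⨿ X)) (coprod.desc coprod.inr coprod.inl) = 𝟙 (X ⨿ X) := by
      ext <;> simp [coprod.inl_desc]
    rw [h, pureKl_id, Category.comp_id]
  have h2 : l = pureKl T coprod.inl ≫ injJoin T (X ⨿ X) ≫
      pureKl T (coprod.map (coprod.desc (𝟙 X) (𝟙 X)) (coprod.desc (𝟙 X) (𝟙 X))) := by
    rw [← Category.assoc, ← hl, Category.assoc, ← pureKl_comp, coprod.map_map, coprod.inl_desc,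
      coprod.map_id_id, pureKl_id, Category.comp_id]
  rw [h1, h2, injJoin_comp_pureKl, coprod.inl_map, coprod.inr_map, pureKl_comp, pureKl_comp]
  calc _ ≤ pureKl T coprod.inl ≫ pureKl T (coprod.desc (𝟙 X) (𝟙 X)) ≫ injJoin T X :=
        comp_le_comp_left _ (sup_le (comp_le_comp_left _ le_sup_left)
          (comp_le_comp_left _ le_sup_right))
    _ = injJoin T X := by
        rw [← Category.assoc, ← pureKl_comp, coprod.inl_desc, pureKl_id, Category.id_comp]

/-- Over a finitely extensive category, a monad preserving weak pullbacks has joins that are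
stable under precomposition with morphisms of the base. -/
theorem pureRightDistributive_of_finitaryExtensive [HasPullbacks C] [FinitaryExtensive C]
    (hT : PreservesWeakPullbacks T.toFunctor) : PureRightDistributive T := by
  intro W X Y j f g
  refine le_antisymm ?_ (sup_le (comp_le_comp_left _ le_sup_left) (comp_le_comp_left _ le_sup_right))
  -- It suffices to treat the universal join `inl ∨ inr`, since `f ∨ g` is its composite with `[f,
  -- g]`. Its restriction along `j` comes from some `l` over the identity of `W`, which `le_injJoin`
  -- bounds.
  obtain ⟨l, hl₁, hl₂⟩ := exists_kleisli_lift_codiag hT j (pureKl T j ≫ injJoin T X)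
    (by rw [Category.assoc, injJoin_comp_codiag, Category.comp_id])
  have hinl : pureKl T coprod.inl ≫ (kl (coprod.desc f.of g.of) : Kleisli.mk T (X ⨿ X) ⟶ _) = f :=
    Kleisli.hom_ext (by rw [pureKl_comp_of]; exact coprod.inl_desc _ _)
  have hinr : pureKl T coprod.inr ≫ (kl (coprod.desc f.of g.of) : Kleisli.mk T (X ⨿ X) ⟶ _) = g :=
    Kleisli.hom_ext (by rw [pureKl_comp_of]; exact coprod.inr_desc _ _)
  have hfg : f ⊔ g = injJoin T X ≫ kl (coprod.desc f.of g.of) := by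
    rw [injJoin, OmegaCpoJoinEnriched.sup_comp, hinl, hinr]
  calc pureKl T j ≫ (f ⊔ g)
      = l ≫ pureKl T (coprod.map j j) ≫ kl (coprod.desc f.of g.of) := by
        rw [hfg, ← Category.assoc, ← hl₂, Category.assoc]
    _ ≤ injJoin T W ≫ pureKl T (coprod.map j j) ≫ kl (coprod.desc f.of g.of) :=
        comp_le_comp_right (le_injJoin hT l hl₁) _
    _ = pureKl T j ≫ f ⊔ pureKl T j ≫ g := by
        rw [← Category.assoc, injJoin_comp_pureKl, coprod.inl_map, coprod.inr_map, pureKl_comp,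
          pureKl_comp, OmegaCpoJoinEnriched.sup_comp, Category.assoc, Category.assoc, hinl, hinr]

end Extensive

/-! ### Saturation and GSOS laws -/

section Saturation

theorem GSOSLaw.lift_hom [HasBinaryProducts C] {S T : Monad C} (lam : GSOSLaw S T.toFunctor) {X Y : C}
    {f : Kleisli.mk T X ⟶ Kleisli.mk T X} {g : Kleisli.mk T Y ⟶ Kleisli.mk T Y} {p : X ⟶ Y}
    (h : f.of ≫ T.map p = p ≫ g.of) :
    (lam.lift f).of ≫ T.map (S.map p) = S.map p ≫ (lam.lift g).of := by
  have h' : prod.lift (𝟙 X) f.of ≫ prod.map p (T.map p) = p ≫ prod.lift (𝟙 Y) g.of := by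
    rw [prod.lift_map, prod.comp_lift, h, Category.id_comp, Category.comp_id]
  change (S.map (prod.lift (𝟙 X) f.of) ≫ lam.app X) ≫ T.map (S.map p) =
    S.map p ≫ S.map (prod.lift (𝟙 Y) g.of) ≫ lam.app Y
  rw [Category.assoc, ← lam.naturality p, ← S.map_comp_assoc, h', S.map_comp_assoc]

variable [HasBinaryProducts C] {S T : Monad C} [OmegaCpoJoinEnriched (Kleisli T)]
  {lam : GSOSLaw S T.toFunctor}

theorem GSOSLaw.Continuity.lift_mono (hcont : lam.Continuity) {X : C}
    {f g : Kleisli.mk T X ⟶ Kleisli.mk T X} (h : f ≤ g) : lam.lift f ≤ lam.lift g := by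
  have hm : Monotone (fun n : ℕ => if n = 0 then f else g) := by
    refine monotone_nat_of_le_succ fun n => ?_
    by_cases hn : n = 0 <;> simp [hn, h]
  have hs : IsLUB (Set.range fun n : ℕ => if n = 0 then f else g) g := by
    refine ⟨?_, fun b hb => by simpa using hb ⟨1, rfl⟩⟩
    rintro _ ⟨n, rfl⟩
    by_cases hn : n = 0 <;> simp [hn, h]
  simpa using (hcont _ _ hm hs).1 ⟨0, rfl⟩

theorem rtIter_add {K : Type*} [Category K] [OmegaCpoJoinEnriched K] {X : K} (α : X ⟶ X)
    (m n : ℕ) : rtIter α m ≫ rtIter α n = rtIter α (m + n) := by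
  induction n with
  | zero => simp [rtIter]
  | succ n ih => rw [← Nat.add_assoc, rtIter, ← Category.assoc, ih, rtIter]

/-- Unitality handles the first power of `id ∨ f`, and observability doubles the exponent. Powers of
two are cofinal in the chain of iterates, so continuity passes to the supremum. -/
theorem GSOSLaw.lift_rtClosure_le (hcont : lam.Continuity) (hunit : lam.Unitality)
    (hobs : lam.Observability) {X : C} (f : Kleisli.mk T X ⟶ Kleisli.mk T X) :
    lam.lift (rtClosure f) ≤ rtClosure (lam.lift f) := by
  have hpow : ∀ n, lam.lift (rtIter f (2 ^ n)) ≤ rtClosure (lam.lift f) := by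
    intro n
    induction n with
    | zero => simpa [rtIter] using hunit f
    | succ n ih =>
      rw [pow_succ, mul_two, ← rtIter_add]
      exact (hobs _).trans (rtClosure_le_of_le ih)
  refine (hcont _ _ (rtIter_monotone f) (isLUB_rtClosure f)).2 ?_
  rintro _ ⟨n, rfl⟩
  exact (hcont.lift_mono (rtIter_monotone f Nat.lt_two_pow_self.le)).trans (hpow n)

theorem GSOSLaw.rtClosure_lift_rtClosure (hcont : lam.Continuity) (hunit : lam.Unitality)
    (hobs : lam.Observability) {X : C} (f : Kleisli.mk T X ⟶ Kleisli.mk T X) :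
    rtClosure (lam.lift (rtClosure f)) = rtClosure (lam.lift f) :=
  le_antisymm (rtClosure_le_of_le (GSOSLaw.lift_rtClosure_le hcont hunit hobs f))
    (rtClosure_le_of_le ((hcont.lift_mono (le_rtClosure f)).trans (le_rtClosure _)))

end Saturation

/-! ### Free algebras -/

section FreeAlgebra

variable {Sig : C ⥤ C} {L : C ⥤ Endofunctor.Algebra Sig}

/-- The terms of depth one: `Σ X ⟶ Σ^* X`. -/
def shallowTerms (adj : L ⊣ Endofunctor.Algebra.forget Sig) (X : C) :
    Sig.obj X ⟶ adj.toMonad.obj X :=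
  Sig.map (adj.unit.app X) ≫ (L.obj X).str

/-- The map `Σ^* X ⟶ A` is the algebra homomorphism extending `r`, so on depth-one terms it applies
`r` and then one operation of `A`. -/
theorem shallowTerms_comp (adj : L ⊣ Endofunctor.Algebra.forget Sig) (A : Endofunctor.Algebra Sig)
    {X : C} (r : X ⟶ A.a) :
    shallowTerms adj X ≫ adj.toMonad.map r ≫ emAlgebra adj A = Sig.map r ≫ A.str := by
  have hom : ∀ (φ : L.obj X ⟶ A) (u : X ⟶ (L.obj X).a),
      (Sig.map u ≫ (L.obj X).str) ≫ φ.f = Sig.map (u ≫ φ.f) ≫ A.str := by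
    intro φ u
    rw [Category.assoc, ← φ.h, Sig.map_comp, Category.assoc]
  have hunit : adj.unit.app X ≫ (L.map r ≫ adj.counit.app A).f = r := by
    refine (adj.homEquiv_unit (f := L.map r ≫ adj.counit.app A)).symm.trans ?_
    exact (congrArg (adj.homEquiv X A) (adj.homEquiv_counit X A r).symm).trans
      ((adj.homEquiv X A).apply_symm_apply r)
  exact (hom (L.map r ≫ adj.counit.app A) (adj.unit.app X)).trans
    (congrArg (fun q => Sig.map q ≫ A.str) hunit)

end FreeAlgebra

/-! ### Behavioural equivalence -/

section Coalgebra

theorem comp_eq_of_isTerminal {F : C ⥤ C} {Z : Endofunctor.Coalgebra F} (hZ : IsTerminal Z) {X : C}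
    (e : X ⟶ F.obj X) {p q : X ⟶ Z.V} (hp : e ≫ F.map p = p ≫ Z.str)
    (hq : e ≫ F.map q = q ≫ Z.str) : p = q := by
  let p' : (⟨X, e⟩ : Endofunctor.Coalgebra F) ⟶ Z := ⟨p, hp⟩
  let q' : (⟨X, e⟩ : Endofunctor.Coalgebra F) ⟶ Z := ⟨q, hq⟩
  exact congrArg Endofunctor.Coalgebra.Hom.f (hZ.hom_ext p' q')

theorem coalgebraHom_comp {F : C ⥤ C} {X Y W : C} {e : X ⟶ F.obj X} {f : Y ⟶ F.obj Y}
    {g : W ⟶ F.obj W} {p : X ⟶ Y} {q : Y ⟶ W} (hp : e ≫ F.map p = p ≫ f)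
    (hq : f ≫ F.map q = q ≫ g) : e ≫ F.map (p ≫ q) = (p ≫ q) ≫ g := by
  rw [F.map_comp, reassoc_of% hp, hq, Category.assoc]

theorem isBisimulation_pullback [HasPullbacks C] {F : C ⥤ C} (hF : PreservesWeakPullbacks F)
    {X W : C} {f : X ⟶ F.obj X} {g : W ⟶ F.obj W} {p : X ⟶ W} (hp : f ≫ F.map p = p ≫ g) :
    IsBisimulation F f (pullback.fst p p) (pullback.snd p p) := by
  have hw : IsWeakPullback (pullback.fst p p) (pullback.snd p p) p p :=
    { w := pullback.condition
      exists_lift := fun a b hab => 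
        ⟨pullback.lift a b hab, pullback.lift_fst _ _ _, pullback.lift_snd _ _ _⟩ }
  refine (hF hw).exists_lift _ _ ?_
  rw [Category.assoc, Category.assoc, hp, pullback.condition_assoc]

theorem relatedBy_pullback_iff [HasPullbacks C] {X W U : C} (p : X ⟶ W) (x y : U ⟶ X) :
    RelatedBy (pullback.fst p p) (pullback.snd p p) x y ↔ x ≫ p = y ≫ p := by
  constructor
  · rintro ⟨u, rfl, rfl⟩
    rw [Category.assoc, Category.assoc, pullback.condition]
  · exact fun h => 
      ⟨pullback.lift x y h, pullback.lift_fst _ _ _, pullback.lift_snd _ _ _⟩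

end Coalgebra

end WeakBisim

/-! ### The congruence theorem -/

open WeakBisim in
theorem corollary3p10 {C : Type*} [Category C] [HasFiniteLimits C]
    (Sig : C ⥤ C) {L : C ⥤ Endofunctor.Algebra Sig}
    (adj : L ⊣ Endofunctor.Algebra.forget Sig)
    (T : Monad C) [WeakBisim.OmegaCpoJoinEnriched (Kleisli T)]
    (hC : FinitaryExtensive C ∨ WeakBisim.PureRightDistributive T)
    (hT : WeakBisim.PreservesWeakPullbacks T.toFunctor)
    (lam : WeakBisim.GSOSLaw adj.toMonad T.toFunctor)
    (hcont : lam.Continuity) (hunit : lam.Unitality) (hobs : lam.Observability)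
    (A : Endofunctor.Algebra Sig) (hA : Nonempty (IsInitial A))
    (Z : Endofunctor.Coalgebra T.toFunctor) (hZ : Nonempty (IsTerminal Z))
    (h : A.a ⟶ T.obj A.a) (hh : WeakBisim.IsBialgebra adj lam A h) :
    ∃ (R : C) (r₁ r₂ : R ⟶ A.a),
      WeakBisim.IsGreatestWeakBisimulation T h r₁ r₂ ∧
      (∀ {U : C} (x y : U ⟶ A.a),
        WeakBisim.WeaklyBisimilar T h x y ↔ WeakBisim.RelatedBy r₁ r₂ x y) ∧
      WeakBisim.IsCongruence A r₁ r₂ := by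
  have hP : PureRightDistributive T :=
    hC.elim (fun _ => pureRightDistributive_of_finitaryExtensive hT) (fun hP => hP)
  obtain ⟨hZ⟩ := hZ
  let sat : Endofunctor.Coalgebra T.toFunctor := ⟨A.a, (rtClosure (kl h)).of⟩
  let beh : A.a ⟶ Z.V := (hZ.from sat).f
  have hbeh : (rtClosure (kl h)).of ≫ T.map beh = beh ≫ Z.str := (hZ.from sat).h
  have hR := isBisimulation_pullback hT hbeh
  have hgreatest : ∀ {Q : C} (q₁ q₂ : Q ⟶ A.a), IsWeakBisimulation T h q₁ q₂ →
      q₁ ≫ beh = q₂ ≫ beh := by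
    rintro Q q₁ q₂ ⟨e, he₁, he₂⟩
    exact comp_eq_of_isTerminal hZ e (coalgebraHom_comp he₁ hbeh) (coalgebraHom_comp he₂ hbeh)
  -- The bialgebra law says that `a^#` is a homomorphism from `lift h` to `h`; closure preserves
  -- this.
  have hem : (rtClosure (lam.lift (kl h))).of ≫ T.map (emAlgebra adj A) =
      emAlgebra adj A ≫ (rtClosure (kl h)).of := by
    refine rtClosure_hom hP ?_
    refine (Category.assoc _ _ _).trans ?_
    exact hh.symm
  refine ⟨pullback beh beh, pullback.fst beh beh, pullback.snd beh beh, ⟨hR, ?_⟩, ?_, ?_, ?_, ?_⟩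
  · intro Q q₁ q₂ hq
    exact (relatedBy_pullback_iff beh q₁ q₂).2 (hgreatest q₁ q₂ hq)
  · refine fun x y => ⟨?_, fun hxy => ⟨_, _, _, hR, hxy⟩⟩
    rintro ⟨Q, q₁, q₂, hq, u, rfl, rfl⟩
    rw [relatedBy_pullback_iff, Category.assoc, Category.assoc, hgreatest q₁ q₂ hq]
  · exact fun u v h₁ h₂ => pullback.hom_ext h₁ h₂
  · intro U
    simp only [relatedBy_pullback_iff]
    exact ⟨fun _ => rfl, Eq.symm, Eq.trans⟩
  · obtain ⟨e, he₁, he₂⟩ := hR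
    have hterm : ∀ r : pullback beh beh ⟶ A.a, e ≫ T.map r = r ≫ (rtClosure (kl h)).of →
        (rtClosure (lam.lift (kl e))).of ≫ T.map ((adj.toMonad.map r ≫ emAlgebra adj A) ≫ beh) =
          ((adj.toMonad.map r ≫ emAlgebra adj A) ≫ beh) ≫ Z.str := by
      intro r hr
      -- As `r` is a homomorphism into `h^*` rather than `h`, the target here is `(lift h^*)^*`; the
      -- criteria replace it by `(lift h)^*`, the source in `hem`.
      have h1 := rtClosure_hom hP (lam.lift_hom (f := kl e) (g := rtClosure (kl h)) hr)
      rw [GSOSLaw.rtClosure_lift_rtClosure hcont hunit hobs] at h1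
      exact coalgebraHom_comp (coalgebraHom_comp h1 hem) hbeh
    have heq := comp_eq_of_isTerminal hZ _ (hterm _ he₁) (hterm _ he₂)
    refine (relatedBy_pullback_iff beh _ _).2 ?_
    rw [← shallowTerms_comp adj, ← shallowTerms_comp adj]
    exact (Category.assoc _ _ _).trans
      ((congrArg (shallowTerms adj _ ≫ ·) heq).trans (Category.assoc _ _ _).symm)
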